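/- **Theorem 4.2.** Let $e\ge 2$ and let $\mathcal R_e$ be a finite commutative chain ring with maximal ideal $\langle\gamma\rangle$, where $\gamma$ has nilpotency index $e$, and let the residue field $\mathcal R_e/\langle\gamma\rangle$ have order $p^m$ with $p$ prime and $m\ge1$. Let $\zeta\in\mathcal R_e$ have multiplicative order $p^m-1$ and let $\mathcal T_e=\{0,1,\zeta,\dots,\zeta^{p^m-2}\}$ be the Teichmüller set of $\mathcal R_e$. Let $n,s\ge 1$ be integers, and let $\lambda=\lambda_0^{p^s}+\gamma\omega$ be a unit of $\mathcal R_e$, where $\omega$ is a unit of $\mathcal R_e$ and $\lambda_0\in\mathcal T_e$ is such that $x^n-\lambda_0$ is irreducible in $\mathcal R_e[x]$. Let $0\le\nu\le ep^s$ and let $\mathcal C=\langle (x^n-\lambda_0)^\nu\rangle$ be the ideal of $\mathcal R_e[x]/\langle x^{np^s}-\lambda\rangle$ generated by $(x^n-\lambda_0)^\nu$, viewed as a $\lambda$-constacyclic code of length $np^s$ over $\mathcal R_e$ through $(a_0,\dots,a_{np^s-1})\mapsto a_0+a_1x+\cdots+a_{np^s-1}x^{np^s-1}+\langle x^{np^s}-\lambda\rangle$.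 Let $d_H(\mathcal C)$ be the Hamming distance of $\mathcal C$, that is, the least number of non-zero components of a non-zero codeword, with $d_H(\{0\})=0$. Then $$d_H(\mathcal C)=\begin{cases} 1 & \text{if } 0\le\nu\le (e-1)p^s;\\ \ell+2 & \text{if } (e-1)p^s+\ell p^{s-1}+1\le\nu\le (e-1)p^s+(\ell+1)p^{s-1} \text{ with } 0\le\ell\le p-2;\\ (i+1)p^k & \text{if } ep^s-p^{s-k}+(i-1)p^{s-k-1}+1\le\nu\le ep^s-p^{s-k}+ip^{s-k-1}\\ & \text{with } 1\le i\le p-1 \text{ and } 1\le k\le s-1;\\ 0 & \text{if } \nu=ep^s. \end{cases}$$ -/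

import Mathlib

open Polynomial

noncomputable section

/-- The ring `R[x]/⟨x^N - lam⟩`. -/
abbrev ConstaRing (R : Type*) [CommRing R] (N : ℕ) (lam : R) : Type _ :=
  R[X] ⧸ Ideal.span {(X ^ N - C lam : R[X])}

/-- The `R`-linear map `R^N → R[x]/⟨x^N - lam⟩`,
`(a_0, …, a_{N-1}) ↦ a_0 + a_1 x + ⋯ + a_{N-1} x^{N-1} + ⟨x^N - lam⟩`
(an isomorphism for `N ≥ 1`). -/
def wordToQuotient {R : Type*} [CommRing R] (N : ℕ) (lam : R) :
    (Fin N → R) →ₗ[R] ConstaRing R N lam where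
  toFun a := Ideal.Quotient.mk _ (∑ i : Fin N, C (a i) * X ^ (i : ℕ))
  map_add' a b := by
    simp only [Pi.add_apply, map_add, add_mul, Finset.sum_add_distrib]
  map_smul' r a := by
    have h : (∑ i : Fin N, C ((r • a) i) * X ^ (i : ℕ) : R[X])
        = r • ∑ i : Fin N, C (a i) * X ^ (i : ℕ) := by
      rw [Finset.smul_sum]
      refine Finset.sum_congr rfl fun i _ => ?_
      rw [Pi.smul_apply, smul_eq_mul, C_mul, mul_assoc, smul_eq_C_mul]
    rw [h]
    rfl

/-- The `lam`-constacyclic code of length `N` over `R` generated by the polynomial `g`: the words in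
`R^N` that correspond to the elements of the ideal `⟨g⟩` of `R[x]/⟨x^N - lam⟩`. -/
def constacyclicCode {R : Type*} [CommRing R] (N : ℕ) (lam : R) (g : R[X]) :
    Submodule R (Fin N → R) :=
  ((Ideal.span {(Ideal.Quotient.mk _ g : ConstaRing R N lam)}).restrictScalars R).comap
    (wordToQuotient N lam)

/-- The Hamming distance `min {w_H(c) : c ∈ 𝒞 \ {0}}` of a code. The zero code has distance `0`,
since `sInf ∅ = 0` in `ℕ`. -/
def codeHammingDistance {R : Type*} [CommRing R] [DecidableEq R] {N : ℕ}
    (𝒞 : Submodule R (Fin N → R)) : ℕ :=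
  sInf {w : ℕ | ∃ c ∈ 𝒞, c ≠ 0 ∧ w = hammingNorm c}

/-- The Teichmüller set `{0, 1, ζ, …, ζ^(q-2)}`, where `q` is the order of the residue field
and `ζ` has multiplicative order `q - 1`. -/
def teichmullerSet {R : Type*} [CommRing R] (ζ : R) (q : ℕ) : Set R :=
  {r | r = 0 ∨ ∃ j : ℕ, j ≤ q - 2 ∧ r = ζ ^ j}

end

/-! In the quotient ring, $(x^n-\lambda_0)^{p^s}$ is $\gamma$ times a unit, so for $\nu=(e-1)p^s+v$
the code is generated by $\gamma^{e-1}(x^n-\lambda_0)^v$ (`span_mk_pow_eq`). The annihilator of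
$\gamma^{e-1}$ is $\langle\gamma\rangle$, so $\gamma^{e-1}f$ has the weight of $f$ mod $\gamma$.
What remains is to find the least weight of a nonzero multiple of $(x^n-a)^v$ of degree below $np^s$
over a field of characteristic $p$.

Lower bound (`mul_pow_le_card_support`): peel off the leading base-$p$ digit of the multiplicity.
With $Q=p^{s-1}$ and $b=a^Q$, write $f=(X^Q-b)^d q$ with $d$ maximal. Each nonzero coefficient of
$g=q \bmod (X^Q-b)$ forces $d+1$ nonzero coefficients of $f$ in its index class mod $Q$; induction
applies to $g$. Upper bound: the power of $x^n-a$ with the largest exponent in the range, which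
Frobenius makes sparse. -/

namespace Polynomial

/-! ### Splitting a polynomial by residue classes of exponents -/

section Stride

variable {A : Type*} [CommRing A]

/-- The polynomial whose coefficients are those of `f` at the indices `j, j + n, j + 2 * n, …`. -/
noncomputable def stride (n j : ℕ) (f : A[X]) : A[X] :=
  ∑ i ∈ Finset.range (f.natDegree + 1), monomial i (f.coeff (j + n * i))

theorem coeff_stride {n : ℕ} (hn : 0 < n) (j i : ℕ) (f : A[X]) :
    (stride n j f).coeff i = f.coeff (j + n * i) := by
  simp only [stride, finsetSum_coeff, coeff_monomial, Finset.sum_ite_eq', Finset.mem_range]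
  split_ifs with h
  · rfl
  · refine (coeff_eq_zero_of_natDegree_lt ?_).symm
    have : i ≤ n * i := Nat.le_mul_of_pos_left i hn
    omega

/-- A polynomial in $X^n$ moves exponents only within their class mod $n$, so taking a component is
linear over $A[X^n]$. -/
theorem stride_expand_mul {n j : ℕ} (hj : j < n) (g f : A[X]) :
    stride n j (expand A n g * f) = g * stride n j f := by
  have hn : 0 < n := by omega
  induction g using Polynomial.induction_on' with
  | add g₁ g₂ h₁ h₂ =>
    ext i
    have e₁ := congrArg (coeff · i) h₁
    have e₂ := congrArg (coeff · i) h₂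
    simp only [coeff_stride hn] at e₁ e₂
    rw [coeff_stride hn, map_add, add_mul, add_mul, coeff_add, coeff_add, e₁, e₂]
  | monomial m r =>
    ext i
    rw [coeff_stride hn, expand_monomial, ← C_mul_X_pow_eq_monomial, ← C_mul_X_pow_eq_monomial,
      mul_assoc, mul_assoc, coeff_C_mul, coeff_C_mul, coeff_X_pow_mul', coeff_X_pow_mul',
      coeff_stride hn]
    by_cases h : m ≤ i
    · obtain ⟨c, rfl⟩ := Nat.exists_eq_add_of_le h
      have : j + n * (m + c) - m * n = j + n * c := by
        rw [mul_add, mul_comm m n]; omega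
      rw [if_pos h, if_pos (by nlinarith), this, Nat.add_sub_cancel_left]
    · rw [if_neg h, if_neg]
      intro h'
      have : m * n ≥ (i + 1) * n := Nat.mul_le_mul_right n (by omega)
      nlinarith

theorem natDegree_stride_lt {n j M : ℕ} (hn : 0 < n) {f : A[X]} (hM : 0 < M)
    (hf : f.natDegree < n * M) : (stride n j f).natDegree < M := by
  rw [← Nat.le_sub_one_iff_lt hM, natDegree_le_iff_coeff_eq_zero]
  intro i hi
  rw [coeff_stride hn]
  refine coeff_eq_zero_of_natDegree_lt (hf.trans_le ?_)
  have : n * M ≤ n * i := Nat.mul_le_mul_left n (by omega)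
  omega

theorem exists_stride_ne_zero {n : ℕ} (hn : 0 < n) {f : A[X]} (hf : f ≠ 0) :
    ∃ j < n, stride n j f ≠ 0 := by
  refine ⟨f.natDegree % n, Nat.mod_lt _ hn, fun h => hf ?_⟩
  have := coeff_stride hn (f.natDegree % n) (f.natDegree / n) f
  rwa [h, coeff_zero, Nat.mod_add_div, coeff_natDegree, eq_comm, leadingCoeff_eq_zero] at this

theorem sum_card_support_stride_le {n : ℕ} (hn : 0 < n) (f : A[X]) :
    ∑ j ∈ Finset.range n, (stride n j f).support.card ≤ f.support.card := by
  rw [Finset.card_eq_sum_card_fiberwise (s := f.support) (f := (· % n)) (t := Finset.range n)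
    fun i _ => Finset.mem_coe.2 (Finset.mem_range.2 (Nat.mod_lt i hn))]
  refine Finset.sum_le_sum fun j hj => ?_
  refine Finset.card_le_card_of_injOn (fun i => j + n * i) (fun i hi => ?_) ?_
  · rw [Finset.mem_coe, mem_support_iff, coeff_stride hn] at hi
    rw [Finset.mem_coe, Finset.mem_filter, mem_support_iff]
    refine ⟨hi, ?_⟩
    dsimp only
    rw [Nat.add_mul_mod_self_left, Nat.mod_eq_of_lt (Finset.mem_range.1 hj)]
  · intro i _ i' _ h
    exact Nat.eq_of_mul_eq_mul_left hn (by simpa using h)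

theorem eq_sum_X_pow_mul_expand_stride {n : ℕ} (hn : 0 < n) (f : A[X]) :
    f = ∑ j ∈ Finset.range n, X ^ j * expand A n (stride n j f) := by
  ext i
  rw [finsetSum_coeff, Finset.sum_eq_single (i % n)]
  · rw [coeff_X_pow_mul', if_pos (Nat.mod_le i n), coeff_expand hn, if_pos (Nat.dvd_sub_mod i),
      coeff_stride hn, Nat.mul_div_cancel' (Nat.dvd_sub_mod i),
      Nat.add_sub_cancel' (Nat.mod_le i n)]
  · intro j hj hne
    rw [coeff_X_pow_mul']
    split_ifs with h
    · rw [coeff_expand hn, if_neg]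
      intro hd
      apply hne
      have := (Nat.modEq_iff_dvd' h).2 hd
      rw [← Nat.mod_eq_of_lt (Finset.mem_range.1 hj)]
      exact this
    · rfl
  · exact fun h => absurd (Finset.mem_range.2 (Nat.mod_lt i hn)) h

theorem X_pow_sub_C_dvd_expand_sub (n : ℕ) (b : A) (g : A[X]) :
    (X ^ n - C b) ∣ expand A n g - C (g.eval b) := by
  have h : (X - C b) ∣ g - C (g.eval b) := by
    rw [dvd_iff_isRoot]; simp
  obtain ⟨q, hq⟩ := h
  exact ⟨expand A n q, by simpa using congrArg (expand A n) hq⟩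

end Stride

/-! ### Weights of multiples of $(x^n-a)^v$ in characteristic $p$ -/

section Weight

variable {K : Type*} [Field K]

theorem two_le_card_support {b : K} (hb : b ≠ 0) {g : K[X]} (hg : g ≠ 0)
    (h : (X - C b) ∣ g) : 2 ≤ g.support.card := by
  by_contra! hlt
  have h1 : g.support.card = 1 := by
    have : g.support.card ≠ 0 := by simpa [Finset.card_eq_zero] using hg
    omega
  obtain ⟨m, c, hc, rfl⟩ := card_support_eq_one.1 h1
  rw [dvd_iff_isRoot, IsRoot, eval_mul, eval_C, eval_pow, eval_X] at h
  exact mul_ne_zero hc (pow_ne_zero m hb) h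

/-- In characteristic `p`, a nonzero polynomial of degree less than `p` with a nonzero root of
multiplicity `d` has at least `d + 1` nonzero coefficients. -/
theorem succ_le_card_support_of_pow_dvd {p : ℕ} [CharP K p] {b : K} (hb : b ≠ 0) (d : ℕ) :
    ∀ {g : K[X]}, g ≠ 0 → g.natDegree < p → (X - C b) ^ d ∣ g → d + 1 ≤ g.support.card := by
  induction d with
  | zero =>
    intro g hg _ _
    have : g.support.card ≠ 0 := by simpa [Finset.card_eq_zero] using hg
    omega
  | succ d ih =>
    intro g hg hdeg hdvd
    have h2 := two_le_card_support hb hg ((dvd_pow_self _ d.succ_ne_zero).trans hdvd)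
    set m := g.natDegree
    -- $Xg'-mg$ multiplies the $i$-th coefficient by $i-m$: it loses only the leading term, since
    -- $i,m<p$, and at most one order of vanishing at $b$.
    set θ : K[X] := X * derivative g - C (m : K) * g with hθ
    have hcoeff : ∀ i, θ.coeff i = ((i : K) - m) * g.coeff i := by
      intro i
      rw [hθ, coeff_sub, coeff_C_mul]
      cases i with
      | zero => simp
      | succ i => rw [coeff_X_mul, coeff_derivative]; push_cast; ring
    have hsupp : θ.support = g.support.erase m := by
      ext i
      rw [mem_support_iff, hcoeff, Finset.mem_erase, mem_support_iff, mul_ne_zero_iff]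
      refine and_congr_left fun hi => not_congr ?_
      rw [sub_eq_zero]
      refine ⟨fun h => ?_, fun h => by rw [h]⟩
      have him : i ≤ m := le_natDegree_of_ne_zero hi
      exact Nat.ModEq.eq_of_lt_of_lt ((CharP.natCast_eq_natCast K p).1 h) (by omega) hdeg
    have hcard : θ.support.card + 1 = g.support.card := by
      rw [hsupp]
      exact Finset.card_erase_add_one (by
        rw [mem_support_iff, coeff_natDegree]; exact leadingCoeff_ne_zero.2 hg)
    have hθ0 : θ ≠ 0 := by
      intro h0
      rw [h0, support_zero, Finset.card_empty] at hcard
      omega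
    have hθdeg : θ.natDegree < p := by
      refine lt_of_le_of_lt ?_ hdeg
      refine natDegree_le_iff_coeff_eq_zero.2 fun i hi => ?_
      rw [hcoeff, coeff_eq_zero_of_natDegree_lt hi, mul_zero]
    have hθdvd : (X - C b) ^ d ∣ θ := by
      refine dvd_sub (Dvd.dvd.mul_left ?_ _) (Dvd.dvd.mul_left ((pow_dvd_pow _ d.le_succ).trans hdvd) _)
      simpa using pow_sub_one_dvd_derivative_of_pow_dvd hdvd
    have := ih hθ0 hθdeg hθdvd
    omega

/-- Splitting off the leading base-`p` digit `d` of the multiplicity of the root `a`, where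
`Q` is a power of `p`. -/
theorem exists_mul_card_support_le {p : ℕ} [Fact p.Prime] [CharP K p] {a : K} (ha : a ≠ 0)
    (t v : ℕ) {f : K[X]} (hf : f ≠ 0) (hdeg : f.natDegree < p ^ t * p) (hdvd : (X - C a) ^ v ∣ f) :
    ∃ (d : ℕ) (g : K[X]), d < p ∧ v < p ^ t * (d + 1) ∧ g ≠ 0 ∧ g.natDegree < p ^ t ∧
      (X - C a) ^ (v - p ^ t * d) ∣ g ∧ (d + 1) * g.support.card ≤ f.support.card := by
  have hp : p.Prime := Fact.out
  set Q := p ^ t with hQ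
  have hQ0 : 0 < Q := pow_pos hp.pos t
  set b := a ^ Q
  have hpow : (X - C a) ^ Q = X ^ Q - C b := by
    rw [hQ, sub_pow_char_pow, ← C_pow]
  have hmonic : (X ^ Q - C b).Monic := monic_X_pow_sub_C b hQ0.ne'
  have hQdeg : (X ^ Q - C b).natDegree = Q := natDegree_X_pow_sub_C
  have hfin : FiniteMultiplicity (X ^ Q - C b) f :=
    finiteMultiplicity_of_degree_pos_of_monic
      (natDegree_pos_iff_degree_pos.1 (by omega)) hmonic hf
  obtain ⟨q, hfq, hq⟩ := hfin.exists_eq_pow_mul_and_not_dvd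
  set d := multiplicity (X ^ Q - C b) f
  have hq0 : q ≠ 0 := fun h => hq (h ▸ dvd_zero _)
  have hfdeg : f.natDegree = d * Q + q.natDegree := by
    rw [hfq, (hmonic.pow d).natDegree_mul' hq0, hmonic.natDegree_pow, hQdeg]
  have hdp : d < p := by
    have : d * Q < p * Q := by rw [mul_comm p]; omega
    exact lt_of_mul_lt_mul_right this hQ0.le
  have hqdvd : (X - C a) ^ (v - Q * d) ∣ q := by
    rcases le_total v (Q * d) with h | h
    · rw [Nat.sub_eq_zero_of_le h, pow_zero]; exact one_dvd q
    · refine (mul_dvd_mul_iff_left (pow_ne_zero d hmonic.ne_zero)).1 ?_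
      rw [← hfq]
      rwa [← hpow, ← pow_mul, ← pow_add, Nat.add_sub_cancel' h]
  have hv : v - Q * d < Q := by
    by_contra! h
    exact hq (hpow ▸ (pow_dvd_pow _ h).trans hqdvd)
  -- The remainder of $q$ modulo $X^Q-b$, obtained by putting $X^Q=b$ in each component.
  set g : K[X] := ∑ j ∈ Finset.range Q, C ((stride Q j q).eval b) * X ^ j with hg
  have hgcoeff : ∀ j, g.coeff j = if j < Q then (stride Q j q).eval b else 0 := by
    intro j
    simp [hg, coeff_X_pow]
  have hqg : (X ^ Q - C b) ∣ q - g := by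
    conv_rhs => rw [eq_sum_X_pow_mul_expand_stride hQ0 q]
    rw [hg, ← Finset.sum_sub_distrib]
    refine Finset.dvd_sum fun j _ => ?_
    rw [mul_comm (C _), ← mul_sub]
    exact (X_pow_sub_C_dvd_expand_sub Q b _).mul_left _
  refine ⟨d, g, hdp, by rw [mul_add]; omega, ?_, ?_, ?_, ?_⟩
  · intro h0
    rw [h0, sub_zero] at hqg
    exact hq hqg
  · rw [← Nat.le_sub_one_iff_lt hQ0, natDegree_le_iff_coeff_eq_zero]
    intro i hi
    rw [hgcoeff, if_neg (by omega)]
  · have := hqdvd.sub (((pow_dvd_pow _ hv.le).trans (hpow.dvd)).trans hqg)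
    rwa [sub_sub_cancel] at this
  · have hstride : ∀ j < Q, stride Q j f = (X - C b) ^ d * stride Q j q := by
      intro j hj
      rw [← stride_expand_mul hj]
      conv_lhs => rw [hfq]
      simp
    have hsub : g.support ⊆ Finset.range Q := by
      intro j hj
      rw [mem_support_iff, hgcoeff] at hj
      by_contra h
      exact hj (if_neg (by simpa using h))
    refine le_trans ?_ (sum_card_support_stride_le hQ0 f)
    refine le_trans ?_ (Finset.sum_le_sum_of_subset hsub)
    rw [mul_comm, ← smul_eq_mul]
    refine Finset.card_nsmul_le_sum _ _ _ fun j hj => ?_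
    have hjQ := Finset.mem_range.1 (hsub hj)
    rw [mem_support_iff, hgcoeff, if_pos hjQ] at hj
    refine succ_le_card_support_of_pow_dvd (p := p) (pow_ne_zero Q ha) d ?_
      (natDegree_stride_lt hQ0 hp.pos hdeg) ?_
    · rw [hstride j hjQ]
      refine mul_ne_zero (pow_ne_zero d (X_sub_C_ne_zero b)) fun h => hj ?_
      rw [h, eval_zero]
    · rw [hstride j hjQ]
      exact dvd_mul_right _ _

/-- A lower bound for the weight of a polynomial of degree less than `p ^ s` in characteristic `p`
in terms of the multiplicity of a nonzero root. -/
theorem mul_pow_le_card_support {p : ℕ} [Fact p.Prime] [CharP K p] {a : K} (ha : a ≠ 0) (s : ℕ) :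
    ∀ {k l v : ℕ} {f : K[X]}, k < s → l + 2 ≤ p → f ≠ 0 → f.natDegree < p ^ s →
      (X - C a) ^ v ∣ f → p ^ s + l * p ^ (s - k - 1) + 1 ≤ v + p ^ (s - k) →
      (l + 2) * p ^ k ≤ f.support.card := by
  have hp : p.Prime := Fact.out
  induction s with
  | zero => intro k _ _ _ hk; omega
  | succ s ih =>
    intro k l v f hk hl hf hdeg hdvd hv
    obtain ⟨d, g, hdp, hvd, hg, hgdeg, hgdvd, hle⟩ :=
      exists_mul_card_support_le (p := p) ha s v hf (by rwa [pow_succ] at hdeg) hdvd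
    have hg1 : 1 ≤ g.support.card := by
      have : g.support.card ≠ 0 := by simpa [Finset.card_eq_zero] using hg
      omega
    refine le_trans ?_ hle
    cases k with
    | zero =>
      have hv' : l * p ^ s + 1 ≤ v := by
        rw [Nat.sub_zero, Nat.add_sub_cancel] at hv
        omega
      rw [pow_zero, mul_one]
      have hld : l ≤ d := by
        have : p ^ s * l < p ^ s * (d + 1) := by rw [mul_comm _ l]; omega
        have := lt_of_mul_lt_mul_left this (Nat.zero_le _)
        omega
      -- If $d=l$, then $g$ still vanishes at $a$ and has two terms; if $d>l$, the factor $d+1$ is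
      -- already enough.
      rcases hld.eq_or_lt with rfl | hlt
      · have hg2 : 2 ≤ g.support.card := by
          refine two_le_card_support ha hg ((dvd_pow_self _ ?_).trans hgdvd)
          rw [mul_comm]; omega
        nlinarith
      · nlinarith
    | succ k =>
      have e₁ : s + 1 - (k + 1) = s - k := by omega
      rw [e₁] at hv
      have hle' : p ^ (s - k) ≤ p ^ s := Nat.pow_le_pow_right hp.pos (Nat.sub_le s k)
      -- Here $v>p^s(p-1)$, which forces the leading digit to be $p-1$ and contributes a full factor
      -- $p$.
      have hd : d = p - 1 := by
        have h1 : p ^ s * p < p ^ s * (d + 2) := by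
          rw [pow_succ] at hv
          have : p ^ s * (d + 2) = p ^ s * (d + 1) + p ^ s := by ring
          omega
        have := lt_of_mul_lt_mul_left h1 (Nat.zero_le _)
        omega
      have hpd : p = d + 1 := by have := hp.pos; omega
      have e₂ : p ^ (s + 1) = p ^ s * d + p ^ s := by
        rw [pow_succ, ← Nat.mul_succ, Nat.succ_eq_add_one, ← hpd]
      have := ih (k := k) (l := l) (by omega) hl hg hgdeg hgdvd (by omega)
      calc (l + 2) * p ^ (k + 1) = p * ((l + 2) * p ^ k) := by ring
        _ ≤ (d + 1) * g.support.card := by rw [← hpd]; exact Nat.mul_le_mul_left p this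

/-- The lower bound of `mul_pow_le_card_support` for powers of `X ^ n - a`. -/
theorem mul_pow_le_card_support_of_X_pow_sub_C {p : ℕ} [Fact p.Prime] [CharP K p] {a : K}
    (ha : a ≠ 0) {n s k l v : ℕ} (hn : 0 < n) {f : K[X]} (hk : k < s) (hl : l + 2 ≤ p) (hf : f ≠ 0)
    (hdeg : f.natDegree < n * p ^ s) (hdvd : (X ^ n - C a) ^ v ∣ f)
    (hv : p ^ s + l * p ^ (s - k - 1) + 1 ≤ v + p ^ (s - k)) :
    (l + 2) * p ^ k ≤ f.support.card := by
  have hp : p.Prime := Fact.out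
  obtain ⟨j, hj, hne⟩ := exists_stride_ne_zero hn hf
  refine le_trans ?_ ((Finset.single_le_sum (f := fun j => (stride n j f).support.card)
    (fun _ _ => Nat.zero_le _) (Finset.mem_range.2 hj)).trans (sum_card_support_stride_le hn f))
  refine mul_pow_le_card_support ha s (v := v) hk hl hne
    (natDegree_stride_lt hn (pow_pos hp.pos s) hdeg) ?_ hv
  obtain ⟨q, rfl⟩ := hdvd
  have : (X ^ n - C a) ^ v = expand K n ((X - C a) ^ v) := by simp
  rw [this, stride_expand_mul hj]
  exact dvd_mul_right _ _

theorem card_support_expand_le {A : Type*} [CommRing A] {n : ℕ} (hn : 0 < n) (f : A[X]) :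
    (expand A n f).support.card ≤ f.support.card := by
  classical
  refine (Finset.card_le_card (t := f.support.image fun i => i * n) fun i hi => ?_).trans
    Finset.card_image_le
  rw [mem_support_iff, coeff_expand hn] at hi
  split_ifs at hi with h
  · exact Finset.mem_image.2 ⟨i / n, mem_support_iff.2 hi, Nat.div_mul_cancel h⟩
  · exact absurd rfl hi

/-- The exponent is $(p^k-1)p^{s-k}+i\,p^{s-k-1}$. By Frobenius the two factors are polynomials of
degrees $p^k-1$ and $i$ in powers of $X$, with at most $p^k$ and $i+1$ terms. -/
theorem card_support_X_pow_sub_C_pow_le {p : ℕ} [Fact p.Prime] [CharP K p] (a : K)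
    {n s k i : ℕ} (hn : 0 < n) (hk : k < s) :
    (((X ^ n - C a) ^ (p ^ s - p ^ (s - k) + i * p ^ (s - k - 1)) : K[X])).support.card
      ≤ (i + 1) * p ^ k := by
  have hp : p.Prime := Fact.out
  have hcard : ∀ f : K[X], f.support.card ≤ f.natDegree + 1 := fun f => by
    simpa using Finset.card_le_card (supp_subset_range_natDegree_succ (p := f))
  have hpow : ∀ t m : ℕ, (X ^ n - C a) ^ (m * p ^ t)
      = expand K (n * p ^ t) ((X - C (a ^ p ^ t)) ^ m) := by
    intro t m
    rw [mul_comm, pow_mul, sub_pow_char_pow]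
    simp [pow_mul]
  have hle : ∀ t m : ℕ, ((X ^ n - C a) ^ (m * p ^ t)).support.card ≤ m + 1 := by
    intro t m
    rw [hpow]
    refine (card_support_expand_le (by have := hp.pos; positivity) _).trans ((hcard _).trans_eq ?_)
    rw [natDegree_pow, natDegree_X_sub_C, mul_one]
  have hexp : p ^ s - p ^ (s - k) = (p ^ k - 1) * p ^ (s - k) := by
    rw [Nat.sub_mul, one_mul, ← pow_add, Nat.add_sub_cancel' hk.le]
  have hpk : p ^ k - 1 + 1 = p ^ k := Nat.sub_add_cancel (pow_pos hp.pos k)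
  rw [pow_add, hexp, mul_comm (i + 1)]
  refine card_support_mul_le.trans (Nat.mul_le_mul ?_ (hle _ _))
  exact (hle _ _).trans_eq hpk

end Weight

end Polynomial

/-! ### Words as polynomials of degree less than $N$ -/

section Word

variable {R : Type*} [CommRing R]

/-- The polynomial `a_0 + a_1 x + ⋯ + a_{N-1} x^{N-1}` of a word. -/
noncomputable def wordPolynomial {N : ℕ} (a : Fin N → R) : R[X] :=
  ∑ i : Fin N, C (a i) * X ^ (i : ℕ)

theorem coeff_wordPolynomial {N : ℕ} (a : Fin N → R) (i : Fin N) :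
    (wordPolynomial a).coeff i = a i := by
  rw [wordPolynomial, finsetSum_coeff, Finset.sum_eq_single i]
  · rw [coeff_C_mul, coeff_X_pow, if_pos rfl, mul_one]
  · intro j _ hj
    rw [coeff_C_mul, coeff_X_pow, if_neg, mul_zero]
    exact fun h => hj (Fin.ext h.symm)
  · exact fun h => absurd (Finset.mem_univ i) h

theorem degree_wordPolynomial_lt {N : ℕ} (a : Fin N → R) : (wordPolynomial a).degree < N := by
  rw [wordPolynomial, degree_lt_iff_coeff_zero]
  intro j hj
  rw [finsetSum_coeff]
  refine Finset.sum_eq_zero fun i _ => ?_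
  rw [coeff_C_mul, coeff_X_pow, if_neg, mul_zero]
  have := i.2
  omega

theorem wordPolynomial_coeff {N : ℕ} {f : R[X]} (hf : f.degree < N) :
    wordPolynomial (fun i : Fin N => f.coeff i) = f := by
  ext j
  by_cases hj : j < N
  · exact coeff_wordPolynomial _ ⟨j, hj⟩
  · rw [degree_lt_iff_coeff_zero] at hf
    rw [hf j (by omega)]
    exact (degree_lt_iff_coeff_zero _ _).1 (degree_wordPolynomial_lt _) j (by omega)

theorem wordPolynomial_eq_zero {N : ℕ} {a : Fin N → R} : wordPolynomial a = 0 ↔ a = 0 := by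
  refine ⟨fun h => funext fun i => ?_, fun h => ?_⟩
  · rw [← coeff_wordPolynomial a i, h, coeff_zero, Pi.zero_apply]
  · simp [wordPolynomial, h]

theorem card_support_wordPolynomial [DecidableEq R] {N : ℕ} (a : Fin N → R) :
    (wordPolynomial a).support.card = hammingNorm a := by
  rw [hammingNorm]
  symm
  refine Finset.card_bij (fun i _ => (i : ℕ)) (fun i hi => ?_) (fun i _ j _ h => Fin.ext h) ?_
  · rw [mem_support_iff, coeff_wordPolynomial]
    exact (Finset.mem_filter.1 hi).2
  · intro j hj
    rw [mem_support_iff] at hj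
    have hjN : j < N := by
      by_contra h
      exact hj ((degree_lt_iff_coeff_zero _ _).1 (degree_wordPolynomial_lt a) j (by omega))
    refine ⟨⟨j, hjN⟩, Finset.mem_filter.2 ⟨Finset.mem_univ _, ?_⟩, rfl⟩
    rwa [← coeff_wordPolynomial a ⟨j, hjN⟩]

theorem mem_constacyclicCode {N : ℕ} {lam : R} {g : R[X]} {a : Fin N → R} :
    a ∈ constacyclicCode N lam g ↔
      (Ideal.Quotient.mk _ (wordPolynomial a) : ConstaRing R N lam) ∈
        Ideal.span {(Ideal.Quotient.mk _ g : ConstaRing R N lam)} :=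
  Iff.rfl

/-- Residues modulo `x ^ N - lam` of polynomials of degree less than `N` are distinct. -/
theorem ConstaRing.mk_injOn {N : ℕ} (hN : N ≠ 0) (lam : R) {f g : R[X]}
    (hf : f.degree < N) (hg : g.degree < N)
    (h : (Ideal.Quotient.mk _ f : ConstaRing R N lam) = Ideal.Quotient.mk _ g) : f = g := by
  nontriviality R
  rw [Ideal.Quotient.eq, Ideal.mem_span_singleton] at h
  have hm : (X ^ N - C lam : R[X]).Monic := monic_X_pow_sub_C lam hN
  have hd : (X ^ N - C lam : R[X]).degree = N := degree_X_pow_sub_C (Nat.pos_of_ne_zero hN) lam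
  have hf' := (modByMonic_eq_self_iff hm).2 (hd.symm ▸ hf)
  have hg' := (modByMonic_eq_self_iff hm).2 (hd.symm ▸ hg)
  rw [← hf', ← hg']
  exact modByMonic_eq_of_dvd_sub hm h

theorem codeHammingDistance_eq [DecidableEq R] {N : ℕ} {𝒞 : Submodule R (Fin N → R)} {d : ℕ}
    (hle : ∀ c ∈ 𝒞, c ≠ 0 → d ≤ hammingNorm c) (hex : ∃ c ∈ 𝒞, c ≠ 0 ∧ hammingNorm c ≤ d) :
    codeHammingDistance 𝒞 = d := by
  obtain ⟨c, hc, hc0, hcd⟩ := hex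
  refine le_antisymm (le_trans (Nat.sInf_le ?_) hcd) ?_
  · exact ⟨c, hc, hc0, rfl⟩
  refine le_csInf ⟨_, c, hc, hc0, rfl⟩ ?_
  rintro w ⟨c', hc', hc0', rfl⟩
  exact hle c' hc' hc0'

end Word

/-! ### Reduction from the chain ring to its residue field -/

section ChainRing

variable {R : Type*} [CommRing R]

/-- The binomial cross terms are a multiple of $puy$, hence of $\gamma y$. So
$y^{p^s}\in\langle\gamma\rangle$, $y$ is nilpotent, and the cofactor of $\gamma$ is $\omega$ plus a
nilpotent. -/
theorem exists_isUnit_pow_eq_mul {S : Type*} [CommRing S] {p : ℕ} (hp : p.Prime) (s : ℕ)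
    {γ ω c u y : S} (hpc : (p : S) = γ * c) (hγ : IsNilpotent γ) (hω : IsUnit ω)
    (h : (u + y) ^ p ^ s = u ^ p ^ s + γ * ω) : ∃ w, IsUnit w ∧ y ^ p ^ s = γ * w := by
  obtain ⟨r, hr⟩ := exists_add_pow_prime_pow_eq hp u y s
  have hy : y ^ p ^ s = γ * (ω - c * u * r * y) := by
    rw [hpc] at hr
    linear_combination h - hr
  have hyn : IsNilpotent y := by
    refine (IsNilpotent.pow_iff_pos (pow_pos hp.pos s).ne').1 ?_
    rw [hy]
    exact (Commute.all _ _).isNilpotent_mul_right hγ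
  refine ⟨_, ?_, hy⟩
  rw [sub_eq_add_neg]
  exact ((Commute.all _ _).isNilpotent_mul_left hyn).neg.isUnit_add_left_of_commute hω
    (Commute.all _ _)

theorem isUnit_of_notMem_span {γ : R} (hγ : (Ideal.span {γ}).IsMaximal) (hnil : IsNilpotent γ)
    {r : R} (hr : r ∉ Ideal.span {γ}) : IsUnit r := by
  obtain ⟨t, i, hi, h⟩ := hγ.exists_inv hr
  obtain ⟨b, rfl⟩ := Ideal.mem_span_singleton.1 hi
  refine isUnit_of_mul_isUnit_right (x := t) ?_
  rw [eq_sub_of_add_eq h]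
  exact ((Commute.all γ b).isNilpotent_mul_right hnil).isUnit_one_sub

theorem pow_pred_mul_eq_zero_iff {γ : R} (hγ : (Ideal.span {γ}).IsMaximal) {e : ℕ}
    (hγe : γ ^ (e + 1) = 0) (hγe' : γ ^ e ≠ 0) (r : R) :
    γ ^ e * r = 0 ↔ r ∈ Ideal.span {γ} := by
  refine ⟨fun h => ?_, fun h => ?_⟩
  · by_contra hr
    exact hγe' ((isUnit_of_notMem_span hγ ⟨_, hγe⟩ hr).mul_left_eq_zero.1 h)
  · obtain ⟨b, rfl⟩ := Ideal.mem_span_singleton.1 h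
    rw [← mul_assoc, ← pow_succ, hγe, zero_mul]

/-- The bridge between weights over the ring and over the residue field. From here up to the main
theorem the nilpotency index is $e+1$. -/
theorem support_C_pow_pred_mul {γ : R} (hγ : (Ideal.span {γ}).IsMaximal) {e : ℕ}
    (hγe : γ ^ (e + 1) = 0) (hγe' : γ ^ e ≠ 0) (f : R[X]) :
    (C (γ ^ e) * f).support = (f.map (Ideal.Quotient.mk (Ideal.span {γ}))).support := by
  ext i
  rw [mem_support_iff, mem_support_iff, coeff_C_mul, coeff_map, Ne, Ne,
    pow_pred_mul_eq_zero_iff hγ hγe hγe', Ideal.Quotient.eq_zero_iff_mem]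

theorem charP_quotient_span {γ : R} (hγ : (Ideal.span {γ}).IsMaximal) {p : ℕ} (hp : p.Prime)
    (hpγ : γ ∣ (p : R)) : CharP (R ⧸ Ideal.span {γ}) p := by
  have : Nontrivial (R ⧸ Ideal.span {γ}) := Ideal.Quotient.nontrivial_iff.2 hγ.ne_top
  refine (CharP.charP_iff_prime_eq_zero hp).2 ?_
  rw [← map_natCast (Ideal.Quotient.mk (Ideal.span {γ})), Ideal.Quotient.eq_zero_iff_mem]
  exact Ideal.mem_span_singleton.2 hpγ

variable {γ : R} {e p n s : ℕ} {lam lam0 ω : R}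

/-- In `R[x]/⟨x^{np^s} - lam⟩` the element `(x^n - lam0)^{p^s}` is associated to `γ`. -/
theorem exists_isUnit_mk_pow_eq (hγ : IsNilpotent γ) (hp : p.Prime) (hpγ : γ ∣ (p : R))
    (hω : IsUnit ω) (hlam : lam = lam0 ^ p ^ s + γ * ω) :
    ∃ w : ConstaRing R (n * p ^ s) lam, IsUnit w ∧
      (Ideal.Quotient.mk _ (X ^ n - C lam0) : ConstaRing R (n * p ^ s) lam) ^ p ^ s =
        Ideal.Quotient.mk _ (C γ) * w := by
  obtain ⟨c, hc⟩ := hpγ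
  set φ : R[X] →+* ConstaRing R (n * p ^ s) lam := Ideal.Quotient.mk _
  -- Split $x^n=\lambda_0+(x^n-\lambda_0)$ and use $(x^n)^{p^s}=\lambda$.
  refine exists_isUnit_pow_eq_mul (u := φ (C lam0)) (c := φ (C c)) (ω := φ (C ω)) hp s ?_ ?_ ?_ ?_
  · rw [← map_mul, ← C_mul, ← hc]; simp
  · exact (hγ.map C).map φ
  · exact (hω.map C).map φ
  · rw [← map_add, ← map_pow, ← map_pow, ← map_mul, ← map_add, add_sub_cancel, ← pow_mul,
      ← C_pow, ← C_mul, ← C_add, ← hlam]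
    exact Ideal.Quotient.eq.2 (Ideal.mem_span_singleton_self _)

/-- The power `(x^n - lam0)^{ep^s + v}` generates the same ideal as `γ^e (x^n - lam0)^v`. -/
theorem span_mk_pow_eq (hγ : IsNilpotent γ) (hp : p.Prime) (hpγ : γ ∣ (p : R))
    (hω : IsUnit ω) (hlam : lam = lam0 ^ p ^ s + γ * ω) (e v : ℕ) :
    Ideal.span {(Ideal.Quotient.mk _ ((X ^ n - C lam0) ^ (e * p ^ s + v)) :
        ConstaRing R (n * p ^ s) lam)} =
      Ideal.span {Ideal.Quotient.mk _ (C (γ ^ e) * (X ^ n - C lam0) ^ v)} := by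
  obtain ⟨w, hw, h⟩ := exists_isUnit_mk_pow_eq (n := n) hγ hp hpγ hω hlam
  refine Eq.trans ?_ (Ideal.span_singleton_mul_right_unit (hw.pow e) _)
  congr 2
  rw [pow_add, map_mul, map_mul, mul_comm e, pow_mul (X ^ n - C lam0), map_pow _ _ e,
    map_pow _ _ (p ^ s), h, C_pow, map_pow _ (C γ), mul_pow]
  ring

/-- The words of the code generated by `(x^n - lam0)^{ep^s + v}`, where `γ^{e+1} = 0`. -/
theorem exists_wordPolynomial_eq_of_mem (hγmax : (Ideal.span {γ}).IsMaximal)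
    (hγe : γ ^ (e + 1) = 0) (hp : p.Prime) (hpγ : γ ∣ (p : R)) (hω : IsUnit ω)
    (hlam : lam = lam0 ^ p ^ s + γ * ω) (hn : 0 < n) {v : ℕ} (hv : v ≤ p ^ s)
    {c : Fin (n * p ^ s) → R}
    (hc : c ∈ constacyclicCode (n * p ^ s) lam ((X ^ n - C lam0) ^ (e * p ^ s + v))) :
    ∃ f : R[X], f.degree < ↑(n * p ^ s) ∧ wordPolynomial c = C (γ ^ e) * f ∧
      (X ^ n - C (Ideal.Quotient.mk (Ideal.span {γ}) lam0)) ^ v ∣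
        f.map (Ideal.Quotient.mk (Ideal.span {γ})) := by
  have : Nontrivial (R ⧸ Ideal.span {γ}) := Ideal.Quotient.nontrivial_iff.2 hγmax.ne_top
  have : Nontrivial R := (Ideal.Quotient.mk (Ideal.span {γ})).domain_nontrivial
  have hN : n * p ^ s ≠ 0 := (Nat.mul_pos hn (pow_pos hp.pos s)).ne'
  have : Fact p.Prime := ⟨hp⟩
  rw [mem_constacyclicCode, span_mk_pow_eq ⟨_, hγe⟩ hp hpγ hω hlam, Ideal.mem_span_singleton] at hc
  obtain ⟨b, hb⟩ := hc
  obtain ⟨b, rfl⟩ := Ideal.Quotient.mk_surjective b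
  set M : R[X] := X ^ (n * p ^ s) - C lam
  have hM : M.Monic := monic_X_pow_sub_C lam hN
  have hMd : M.degree = ↑(n * p ^ s) := degree_X_pow_sub_C (Nat.pos_of_ne_zero hN) lam
  set f := ((X ^ n - C lam0) ^ v * b) %ₘ M
  have hfd : f.degree < ↑(n * p ^ s) := hMd ▸ degree_modByMonic_lt _ hM
  have hdvd : M ∣ (X ^ n - C lam0) ^ v * b - f := by
    refine ⟨((X ^ n - C lam0) ^ v * b) /ₘ M, ?_⟩
    rw [sub_eq_iff_eq_add', modByMonic_add_div]
  refine ⟨f, hfd, ?_, ?_⟩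
  · refine ConstaRing.mk_injOn hN lam (degree_wordPolynomial_lt c) ?_ ?_
    · refine lt_of_le_of_lt ?_ hfd
      rw [← smul_eq_C_mul]
      exact degree_smul_le _ _
    · rw [hb, ← map_mul, Ideal.Quotient.eq, Ideal.mem_span_singleton, mul_assoc, ← mul_sub]
      exact hdvd.mul_left _
  · set π := Ideal.Quotient.mk (Ideal.span {γ})
    have hπγ : π γ = 0 := Ideal.Quotient.eq_zero_iff_mem.2 (Ideal.mem_span_singleton_self γ)
    have := charP_quotient_span hγmax hp hpγ
    -- The modulus becomes $(x^n-a)^{p^s}$, so divisibility by $(x^n-a)^v$ survives reduction modulo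
    -- it because $v\le p^s$.
    have hMπ : M.map π = (X ^ n - C (π lam0)) ^ p ^ s := by
      rw [sub_pow_char_pow, ← pow_mul, ← C_pow, Polynomial.map_sub, Polynomial.map_pow, map_X,
        map_C, hlam, map_add, map_mul, hπγ, zero_mul, add_zero, map_pow]
    have h := Polynomial.map_dvd π hdvd
    rw [hMπ, Polynomial.map_sub, Polynomial.map_mul, Polynomial.map_pow, Polynomial.map_sub,
      Polynomial.map_pow, map_X, map_C] at h
    exact (dvd_sub_right (dvd_mul_right _ _)).1 ((pow_dvd_pow _ hv).trans h)

theorem mem_constacyclicCode_of_le (hγ : IsNilpotent γ) (hp : p.Prime) (hpγ : γ ∣ (p : R))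
    (hω : IsUnit ω) (hlam : lam = lam0 ^ p ^ s + γ * ω) {ν v : ℕ} (hν : ν ≤ e * p ^ s + v)
    {c : Fin (n * p ^ s) → R} (hc : wordPolynomial c = C (γ ^ e) * (X ^ n - C lam0) ^ v) :
    c ∈ constacyclicCode (n * p ^ s) lam ((X ^ n - C lam0) ^ ν) := by
  rw [mem_constacyclicCode, hc]
  have h : (Ideal.Quotient.mk _ (C (γ ^ e) * (X ^ n - C lam0) ^ v) : ConstaRing R (n * p ^ s) lam) ∈
      Ideal.span {Ideal.Quotient.mk _ ((X ^ n - C lam0) ^ (e * p ^ s + v))} := by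
    rw [span_mk_pow_eq hγ hp hpγ hω hlam]
    exact Ideal.mem_span_singleton_self _
  exact Ideal.span_singleton_le_span_singleton.2 (map_dvd _ (pow_dvd_pow _ hν)) h

theorem codeHammingDistance_eq_one [DecidableEq R] (hγe : γ ^ (e + 1) = 0) (hγe' : γ ^ e ≠ 0)
    (hp : p.Prime) (hpγ : γ ∣ (p : R)) (hω : IsUnit ω) (hlam : lam = lam0 ^ p ^ s + γ * ω)
    (hn : 0 < n) {ν : ℕ} (hν : ν ≤ e * p ^ s) :
    codeHammingDistance (constacyclicCode (n * p ^ s) lam ((X ^ n - C lam0) ^ ν)) = 1 := by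
  have hN : 0 < n * p ^ s := Nat.mul_pos hn (pow_pos hp.pos s)
  refine codeHammingDistance_eq (fun c _ hc => ?_) ?_
  · exact Nat.pos_of_ne_zero (hammingNorm_ne_zero_iff.2 hc)
  · have hw : wordPolynomial (fun i : Fin (n * p ^ s) => (C (γ ^ e)).coeff i) = C (γ ^ e) :=
      wordPolynomial_coeff (degree_C_le.trans_lt (by exact_mod_cast hN))
    refine ⟨fun i => (C (γ ^ e)).coeff i, ?_, ?_, ?_⟩
    · exact mem_constacyclicCode_of_le (v := 0) ⟨_, hγe⟩ hp hpγ hω hlam hν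
        (by rw [hw, pow_zero, mul_one])
    · rw [Ne, ← wordPolynomial_eq_zero, hw, C_eq_zero]
      exact hγe'
    · rw [← card_support_wordPolynomial, hw]
      simpa using card_support_C_mul_X_pow_le_one (c := γ ^ e) (n := 0)

theorem codeHammingDistance_eq_zero [DecidableEq R] (hγmax : (Ideal.span {γ}).IsMaximal)
    (hγe : γ ^ (e + 1) = 0) (hp : p.Prime) (hpγ : γ ∣ (p : R)) (hω : IsUnit ω)
    (hlam : lam = lam0 ^ p ^ s + γ * ω) (hn : 0 < n) :
    codeHammingDistance
      (constacyclicCode (n * p ^ s) lam ((X ^ n - C lam0) ^ ((e + 1) * p ^ s))) = 0 := by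
  rw [codeHammingDistance]
  convert Nat.sInf_empty
  refine Set.eq_empty_of_forall_notMem ?_
  rintro _ ⟨c, hc, hc0, rfl⟩
  -- With exponent $e+1$ in place of $e$, every word is a multiple of $\gamma^{e+1}=0$.
  obtain ⟨f, -, hf, -⟩ := exists_wordPolynomial_eq_of_mem (v := 0) (e := e + 1) hγmax
    (by rw [pow_succ, hγe, zero_mul]) hp hpγ hω hlam hn (Nat.zero_le _) hc
  rw [hγe, C_0, zero_mul, wordPolynomial_eq_zero] at hf
  exact hc0 hf

/-- Covers both middle cases: $k=0$, $l=\ell$ and $k\ge1$, $l=i-1$. In `hv` the term $p^{s-k}$ is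
moved across to avoid truncated subtraction. -/
theorem codeHammingDistance_eq_mul_pow [DecidableEq R] (hγmax : (Ideal.span {γ}).IsMaximal)
    (hγe : γ ^ (e + 1) = 0) (hγe' : γ ^ e ≠ 0) (hp : p.Prime) (hpγ : γ ∣ (p : R))
    (hω : IsUnit ω) (hlam : lam = lam0 ^ p ^ s + γ * ω) (hlam_unit : IsUnit lam) (hn : 0 < n)
    {k l v : ℕ} (hk : k < s) (hl : l + 2 ≤ p)
    (hv : p ^ s + l * p ^ (s - k - 1) + 1 ≤ v + p ^ (s - k))
    (hv' : v ≤ p ^ s - p ^ (s - k) + (l + 1) * p ^ (s - k - 1)) :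
    codeHammingDistance (constacyclicCode (n * p ^ s) lam ((X ^ n - C lam0) ^ (e * p ^ s + v)))
      = (l + 2) * p ^ k := by
  have : Fact p.Prime := ⟨hp⟩
  let _ : Field (R ⧸ Ideal.span {γ}) := Ideal.Quotient.field _
  set π := Ideal.Quotient.mk (Ideal.span {γ})
  have : Nontrivial R := π.domain_nontrivial
  have hπγ : π γ = 0 := Ideal.Quotient.eq_zero_iff_mem.2 (Ideal.mem_span_singleton_self γ)
  have := charP_quotient_span hγmax hp hpγ
  have ha : π lam0 ≠ 0 := by
    intro h0
    have := (hlam_unit.map π).ne_zero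
    rw [hlam, map_add, map_pow, h0, map_mul, hπγ, zero_mul, add_zero,
      zero_pow (pow_pos hp.pos s).ne'] at this
    exact this rfl
  -- The top of the range: $\gamma^e(x^n-\lambda_0)^t$ lies in every code of the range and attains
  -- the bound.
  set t := p ^ s - p ^ (s - k) + (l + 1) * p ^ (s - k - 1) with ht
  have htlt : t < p ^ s := by
    have h1 : (l + 1) * p ^ (s - k - 1) < p ^ (s - k) := by
      have : s - k = s - k - 1 + 1 := by omega
      conv_rhs => rw [this, pow_succ, mul_comm]
      exact Nat.mul_lt_mul_of_pos_right (by omega) (pow_pos hp.pos _)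
    have h2 : p ^ (s - k) ≤ p ^ s := Nat.pow_le_pow_right hp.pos (Nat.sub_le s k)
    omega
  refine codeHammingDistance_eq (fun c hc hc0 => ?_) ?_
  · obtain ⟨f, hfd, hf, hdvd⟩ := exists_wordPolynomial_eq_of_mem hγmax hγe hp hpγ hω hlam hn
      (hv'.trans htlt.le) hc
    rw [← card_support_wordPolynomial, hf, support_C_pow_pred_mul hγmax hγe hγe']
    have hne : f.map π ≠ 0 := by
      rw [← support_nonempty, ← support_C_pow_pred_mul hγmax hγe hγe', ← hf, support_nonempty]
      exact mt wordPolynomial_eq_zero.1 hc0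
    refine mul_pow_le_card_support_of_X_pow_sub_C ha hn hk hl hne ?_ hdvd hv
    exact (natDegree_lt_iff_degree_lt hne).2 (degree_map_le.trans_lt hfd)
  · have hmap : ((X ^ n - C lam0 : R[X]) ^ t).map π = (X ^ n - C (π lam0)) ^ t := by
      simp
    have hdeg : (C (γ ^ e) * (X ^ n - C lam0) ^ t : R[X]).degree < ↑(n * p ^ s) := by
      rw [← smul_eq_C_mul]
      refine (degree_smul_le _ _).trans_lt (degree_le_natDegree.trans_lt ?_)
      rw [(monic_X_pow_sub_C lam0 hn.ne').natDegree_pow, natDegree_X_pow_sub_C]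
      exact_mod_cast (by rw [mul_comm n]; exact Nat.mul_lt_mul_of_pos_right htlt hn)
    have hw := wordPolynomial_coeff hdeg
    refine ⟨_, mem_constacyclicCode_of_le ⟨_, hγe⟩ hp hpγ hω hlam ?_ hw, ?_, ?_⟩
    · exact Nat.add_le_add_left hv' _
    · rw [Ne, ← wordPolynomial_eq_zero, hw, ← support_eq_empty,
        support_C_pow_pred_mul hγmax hγe hγe', support_eq_empty, hmap]
      exact pow_ne_zero t (monic_X_pow_sub_C _ hn.ne').ne_zero
    · rw [← card_support_wordPolynomial, hw, support_C_pow_pred_mul hγmax hγe hγe', hmap]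
      exact card_support_X_pow_sub_C_pow_le _ hn hk

end ChainRing

/-! ### The four ranges of $\nu$ -/

theorem theorem4p2 {R : Type*} [CommRing R] [Finite R] [DecidableEq R]
    -- `R` is a finite commutative chain ring with maximal ideal `⟨γ⟩` and nilpotency index `e ≥ 2`
    (hchain : IsChain (· ≤ ·) (Set.univ : Set (Ideal R)))
    (γ : R) (hγ : (Ideal.span {γ}).IsMaximal)
    (e : ℕ) (he : 2 ≤ e) (hγe : nilpotencyClass γ = e)
    -- the residue field has characteristic `p` and order `p ^ m`
    (p m : ℕ) (hp : p.Prime) (hm : 0 < m)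
    (hcard : Nat.card (R ⧸ Ideal.span {γ}) = p ^ m)
    -- a generator of the Teichmüller set
    (ζ : R) (hζ : orderOf ζ = p ^ m - 1)
    (n s : ℕ) (hn : 0 < n) (hs : 0 < s)
    (lam lam0 ω : R) (hlam0 : lam0 ∈ teichmullerSet ζ (p ^ m)) (hω : IsUnit ω)
    (hlam : lam = lam0 ^ p ^ s + γ * ω) (hlam_unit : IsUnit lam)
    (hirr : Irreducible (X ^ n - C lam0 : R[X]))
    (ν : ℕ) (hν : ν ≤ e * p ^ s)
    (𝒞 : Submodule R (Fin (n * p ^ s) → R))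
    (h𝒞 : 𝒞 = constacyclicCode (n * p ^ s) lam ((X ^ n - C lam0) ^ ν)) :
    (ν ≤ (e - 1) * p ^ s → codeHammingDistance 𝒞 = 1) ∧
    (∀ l : ℕ, l ≤ p - 2 →
      (e - 1) * p ^ s + l * p ^ (s - 1) + 1 ≤ ν →
      ν ≤ (e - 1) * p ^ s + (l + 1) * p ^ (s - 1) →
      codeHammingDistance 𝒞 = l + 2) ∧
    (∀ i k : ℕ, 1 ≤ i → i ≤ p - 1 → 1 ≤ k → k ≤ s - 1 →
      e * p ^ s - p ^ (s - k) + (i - 1) * p ^ (s - k - 1) + 1 ≤ ν →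
      ν ≤ e * p ^ s - p ^ (s - k) + i * p ^ (s - k - 1) →
      codeHammingDistance 𝒞 = (i + 1) * p ^ k) ∧
    (ν = e * p ^ s → codeHammingDistance 𝒞 = 0) := by
  let _ : Field (R ⧸ Ideal.span {γ}) := Ideal.Quotient.field _
  -- The order $p^m$ of the residue field is zero in it, hence so is $p$.
  have hpγ : γ ∣ (p : R) := by
    rw [← Ideal.mem_span_singleton, ← Ideal.Quotient.eq_zero_iff_mem, map_natCast]
    refine pow_eq_zero_iff hm.ne' |>.1 ?_
    rw [← Nat.cast_pow, ← hcard]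
    have : Finite (R ⧸ Ideal.span {γ}) := Finite.of_surjective _ Ideal.Quotient.mk_surjective
    have := Fintype.ofFinite (R ⧸ Ideal.span {γ})
    rw [Nat.card_eq_fintype_card]
    exact Nat.cast_card_eq_zero _
  obtain ⟨e, rfl⟩ : ∃ e', e = e' + 1 := ⟨e - 1, by omega⟩
  obtain ⟨hγ0, hγ1⟩ := nilpotencyClass_eq_succ_iff.1 hγe
  subst h𝒞
  rw [Nat.add_sub_cancel]
  have hexp : (e + 1) * p ^ s = e * p ^ s + p ^ s := by ring
  refine ⟨fun h => ?_, fun l hl h h' => ?_, fun i k hi hi' hk hk' h h' => ?_, fun h => ?_⟩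
  · exact codeHammingDistance_eq_one hγ0 hγ1 hp hpγ hω hlam hn h
  · obtain ⟨v, rfl⟩ := Nat.exists_eq_add_of_le (show e * p ^ s ≤ ν by omega)
    have := codeHammingDistance_eq_mul_pow (k := 0) (l := l) (v := v) hγ hγ0 hγ1 hp hpγ hω hlam
      hlam_unit hn hs (by have := hp.two_le; omega) (by rw [Nat.sub_zero]; omega)
      (by rw [Nat.sub_zero]; omega)
    rwa [pow_zero, mul_one] at this
  · obtain ⟨l, rfl⟩ : ∃ l, i = l + 1 := ⟨i - 1, by omega⟩
    rw [Nat.add_sub_cancel] at h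
    have hle : p ^ (s - k) ≤ p ^ s := Nat.pow_le_pow_right hp.pos (Nat.sub_le s k)
    obtain ⟨v, rfl⟩ := Nat.exists_eq_add_of_le (show e * p ^ s ≤ ν by omega)
    exact codeHammingDistance_eq_mul_pow (k := k) (l := l) (v := v) hγ hγ0 hγ1 hp hpγ hω hlam
      hlam_unit hn (by omega) (by omega) (by omega) (by omega)
  · rw [h]
    exact codeHammingDistance_eq_zero hγ hγ0 hp hpγ hω hlam hn
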